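/- Let $X$ be a complex Fréchet space (a locally convex topological vector space over $\mathbb{C}$ whose topology is completely metrizable; $X$ need not be separable), and let $T:X\to X$ be a continuous linear operator that is topologically transitive, i.e. for all non-empty open sets $U,V\subseteq X$ there is an integer $n\ge 0$ with $T^nU\cap V\neq\emptyset$. For a map $S:X\to X$ and $z\in X$ let $$L_S(z)=\{y\in X:\ \text{there is a strictly increasing sequence } (k_n) \text{ of positive integers with } S^{k_n}z\to y\},$$ and call $z$ recurrent for $S$ if $z\in L_S(z)$. Let $x\in X$. Then: (i) For every positive integer $p$ the operator $T^p$ is topologically transitive, and there is a dense subset $D$ of $X$, independent of $p$, such that for every positive integer $p$ and every $z\in D$ the vector $z$ is recurrent for $T^p$ and $x\in L_{T^p}(z)$. (ii) For every $\lambda\in\mathbb{C}$ with $|\lambda|=1$ the operator $\lambda T$ is topologically transitive, and there is a dense subset $D$ of $X$, independent of $\lambda$, such that for every $\lambda\in\mathbb{C}$ with $|\lambda|=1$ and every $z\in D$ the vector $z$ is recurrent for $\lambda T$ and $x\in L_{\lambda T}(z)$. -/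

import Mathlib

open Filter Topology

namespace TransitiveOperators

/-- A self-map `f` is topologically transitive if for all non-empty open sets `U`, `V` there is
`n ≥ 0` such that `f^n(U)` meets `V`. -/
def IsTopTransitive {X : Type*} [TopologicalSpace X] (f : X → X) : Prop :=
  ∀ U V : Set X, IsOpen U → IsOpen V → U.Nonempty → V.Nonempty →
    ∃ n : ℕ, ((f^[n] '' U) ∩ V).Nonempty

/-- The limit set `L_f(x)`: all limits of `f^{k_n} x` along strictly increasing sequences
`(k_n)` of positive integers. -/
def limitSet {X : Type*} [TopologicalSpace X] (f : X → X) (x : X) : Set X :=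
  {y | ∃ k : ℕ → ℕ, StrictMono k ∧ (∀ n, 0 < k n) ∧
    Tendsto (fun n => f^[k n] x) atTop (𝓝 y)}

/-- A point is recurrent for `f` if it belongs to its own limit set. -/
def IsRecurrent {X : Type*} [TopologicalSpace X] (f : X → X) (x : X) : Prop :=
  x ∈ limitSet f x

end TransitiveOperators

/-! Birkhoff's Baire category argument needs separability, so one first passes to a closed separable
invariant subspace containing `x` and a point of the given open set, on which transitivity survives
(`exists_separable_submodule`). Vectors with dense orbit are dense there. By the theorems of Ansari
(`denseRange_iterate_pow`) and León-Saavedra–Müller (`denseRange_iterate_smul`) the same vectors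
have dense orbits under all powers and rotations, so `D` depends on neither. Such orbits accumulate
at every point of the subspace, in particular at the vector itself and at `x`; letting `x` vary
gives transitivity.

Both theorems are topological. If `u` has a dense orbit, so does `a • u + b • T u` for `(a, b) ≠ 0`.
For powers, this joins `u` to `T u` by a path of such vectors, along which the coset of the residue
at which they are approached cannot jump. For rotations, it fills in the loop `μ • u`; if the
rotations of `u` lying in its orbit closure were not the whole circle, a circle map of nonzero
degree would extend to the plane. -/

namespace TransitiveOperators

/-! ### Orbit closures graded by time modulo `p` -/

section Residue

variable {E : Type*} [TopologicalSpace E]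

/-- The closure of the part of the orbit of `u` with time congruent to `j` modulo `p`. -/
def residueOrbitClosure (f : E → E) (p : ℕ) (u : E) (j : ZMod p) : Set E :=
  closure {y | ∃ n : ℕ, (n : ZMod p) = j ∧ f^[n] u = y}

lemma mem_residueOrbitClosure_add {f : E → E} (hf : Continuous f) {p : ℕ} {u v w : E}
    {j k : ZMod p} (hv : v ∈ residueOrbitClosure f p u j)
    (hw : w ∈ residueOrbitClosure f p v k) : w ∈ residueOrbitClosure f p u (j + k) := by
  refine closure_minimal ?_ isClosed_closure hw
  rintro _ ⟨n, rfl, rfl⟩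
  refine map_mem_closure (hf.iterate n) hv ?_
  rintro _ ⟨m, rfl, rfl⟩
  exact ⟨n + m, by push_cast; ring, Function.iterate_add_apply _ _ _ _⟩

lemma exists_mem_residueOrbitClosure {f : E → E} {p : ℕ} [NeZero p] {u : E}
    (hu : DenseRange (fun n : ℕ => f^[n] u)) (v : E) :
    ∃ j, v ∈ residueOrbitClosure f p u j := by
  have : v ∈ closure (⋃ j : ZMod p, {y | ∃ n : ℕ, (n : ZMod p) = j ∧ f^[n] u = y}) := by
    refine closure_mono ?_ (hu v)
    rintro _ ⟨n, rfl⟩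
    exact Set.mem_iUnion.2 ⟨n, n, rfl, rfl⟩
  rw [closure_iUnion_of_finite] at this
  exact Set.mem_iUnion.1 this

end Residue

/-! ### Vectors with dense orbit and Ansari's theorem -/

section Hypercyclic

variable {E : Type*} [AddCommGroup E] [Module ℂ E] [TopologicalSpace E]
  [IsTopologicalAddGroup E] [ContinuousSMul ℂ E]

/-- In a locally convex space, a subspace that is not dense is annihilated by a nonzero continuous
linear functional. -/
lemma exists_functional_ne_zero_of_not_dense [LocallyConvexSpace ℝ E] (p : Submodule ℂ E)
    (hp : ¬ Dense (p : Set E)) : ∃ φ : E →L[ℂ] ℂ, φ ≠ 0 ∧ ∀ v ∈ p, φ v = 0 := by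
  obtain ⟨x, hx⟩ : ∃ x, x ∉ closure (p : Set E) := by
    simpa [Dense] using hp
  have hconv : Convex ℝ (p.topologicalClosure : Set E) :=
    (p.topologicalClosure.restrictScalars ℝ).convex
  obtain ⟨φ, s, hs, hsx⟩ := RCLike.geometric_hahn_banach_closed_point (𝕜 := ℂ) hconv
    p.isClosed_topologicalClosure hx
  have hs0 : 0 < s := by simpa using hs 0 (zero_mem _)
  refine ⟨φ, ?_, fun v hv => ?_⟩
  · rintro rfl
    simp at hsx
    linarith
  · by_contra hne
    -- The scaling makes the value of `φ` exactly `s`, against the strict bound.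
    have h1 := hs (((s : ℂ) / φ v) • v)
      (p.le_topologicalClosure (p.smul_mem _ hv))
    simp [hne] at h1

/-- A geometric sequence is bounded if `‖a‖ ≤ 1` and stays away from `0` if `‖a‖ > 1` and `m ≠ 0`.
-/
lemma not_denseRange_pow_mul (a m : ℂ) : ¬ DenseRange (fun n : ℕ => a ^ n * m) := by
  intro h
  rcases eq_or_ne m 0 with rfl | hm
  · obtain ⟨n, hn⟩ := h.exists_mem_open (s := {0}ᶜ) isOpen_compl_singleton ⟨1, by simp⟩
    simp at hn
  rcases le_or_gt ‖a‖ 1 with ha | ha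
  · have hsub : ∀ z : ℂ, z ∈ Metric.closedBall (0 : ℂ) ‖m‖ := by
      intro z
      refine closure_minimal ?_ Metric.isClosed_closedBall (h z)
      rintro _ ⟨n, rfl⟩
      simpa using mul_le_of_le_one_left (norm_nonneg m) (pow_le_one₀ (norm_nonneg a) ha)
    have h2 : ‖2 * m‖ ≤ ‖m‖ := by simpa using hsub (2 * m)
    rw [norm_mul, Complex.norm_two] at h2
    linarith [norm_pos_iff.2 hm]
  · obtain ⟨n, hn⟩ := h.exists_mem_open (s := Metric.ball 0 ‖m‖) Metric.isOpen_ball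
      ⟨0, by simpa using hm⟩
    have h1 := one_le_pow₀ ha.le (n := n)
    have h2 := norm_pos_iff.2 hm
    simp at hn
    nlinarith

/-- A nonzero polynomial of degree at most one in an operator with a dense orbit has dense
range. -/
lemma denseRange_smul_id_add_smul [LocallyConvexSpace ℝ E] {T : E →L[ℂ] E} {u : E}
    (hu : DenseRange (fun n : ℕ => T^[n] u)) {a b : ℂ} (hab : a ≠ 0 ∨ b ≠ 0) :
    DenseRange (fun v => a • v + b • T v) := by
  by_contra hnd
  let P : E →ₗ[ℂ] E := a • LinearMap.id + b • (T : E →ₗ[ℂ] E)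
  obtain ⟨φ, hφ, hφP⟩ := exists_functional_ne_zero_of_not_dense (LinearMap.range P) (by
    simpa [DenseRange, P] using! hnd)
  have hrel : ∀ v, a * φ v + b * φ (T v) = 0 := fun v => by
    simpa [P] using hφP _ ⟨v, rfl⟩
  rcases eq_or_ne b 0 with rfl | hb
  · have ha : a ≠ 0 := by simpa using hab
    exact hφ (by ext v; simpa [ha] using hrel v)
  -- `φ` is an eigenvector of the adjoint, so it sends the dense orbit to a geometric sequence,
  -- which would be dense in `ℂ`.
  · have hT : ∀ v, φ (T v) = (-a / b) * φ v := fun v => by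
      field_simp
      linear_combination hrel v
    have hiter : ∀ n : ℕ, φ (T^[n] u) = (-a / b) ^ n * φ u := fun n => by
      induction n with
      | zero => simp
      | succ n ih => rw [Function.iterate_succ_apply', hT, ih]; ring
    have hsurj : Function.Surjective φ := by
      refine LinearMap.surjective_of_ne_zero (f := (φ : E →ₗ[ℂ] ℂ)) ?_
      exact fun h => hφ (ContinuousLinearMap.coe_injective h)
    refine not_denseRange_pow_mul (-a / b) (φ u) ?_
    have := hsurj.denseRange.comp hu φ.continuous
    simpa [Function.comp_def, hiter] using! this

/-- Applying a nonzero polynomial of degree at most one in `T` to a vector with dense orbit gives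
a vector with dense orbit. -/
lemma denseRange_iterate_smul_add_smul [LocallyConvexSpace ℝ E] {T : E →L[ℂ] E} {u : E}
    (hu : DenseRange (fun n : ℕ => T^[n] u)) {a b : ℂ} (hab : a ≠ 0 ∨ b ≠ 0) :
    DenseRange (fun n : ℕ => T^[n] (a • u + b • T u)) := by
  have hiter : ∀ n : ℕ, T^[n] (a • u + b • T u) = a • T^[n] u + b • T (T^[n] u) := fun n => by
    induction n with
    | zero => simp
    | succ n ih => rw [Function.iterate_succ_apply', ih]; simp [Function.iterate_succ_apply']
  simpa [Function.comp_def, hiter] using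
    (denseRange_smul_id_add_smul hu hab).comp hu (by fun_prop)

lemma denseRange_iterate_add [LocallyConvexSpace ℝ E] {T : E →L[ℂ] E} {u : E}
    (hu : DenseRange (fun n : ℕ => T^[n] u)) (N : ℕ) :
    DenseRange (fun n : ℕ => T^[n] (T^[N] u)) := by
  induction N with
  | zero => simpa using hu
  | succ N ih =>
    simpa [Function.iterate_succ_apply'] using
      denseRange_iterate_smul_add_smul ih (a := 0) (b := 1) (by simp)

/-- Every point is the limit of a subsequence of a dense orbit. -/
lemma mapClusterPt_of_denseRange_iterate [LocallyConvexSpace ℝ E] {T : E →L[ℂ] E} {u : E}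
    (hu : DenseRange (fun n : ℕ => T^[n] u)) (y : E) :
    MapClusterPt y atTop (fun n : ℕ => T^[n] u) := by
  rw [mapClusterPt_iff_frequently]
  intro s hs
  rw [frequently_atTop]
  intro N
  obtain ⟨t, hts, ht, hyt⟩ := mem_nhds_iff.1 hs
  obtain ⟨n, hn⟩ := (denseRange_iterate_add hu N).exists_mem_open ht ⟨y, hyt⟩
  refine ⟨n + N, by omega, hts ?_⟩
  rwa [Function.iterate_add_apply]

/-- **Ansari's theorem**: a vector with dense `T`-orbit has dense `T ^ p`-orbit. -/
theorem denseRange_iterate_pow [LocallyConvexSpace ℝ E] {T : E →L[ℂ] E} {u : E}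
    (hu : DenseRange (fun n : ℕ => T^[n] u)) {p : ℕ} (hp : 0 < p) :
    DenseRange (fun n : ℕ => (T ^ p : E →L[ℂ] E)^[n] u) := by
  have : NeZero p := ⟨hp.ne'⟩
  have hadd {u v w : E} {j k : ZMod p} := mem_residueOrbitClosure_add T.continuous
    (u := u) (v := v) (w := w) (j := j) (k := k)
  let H : AddSubmonoid (ZMod p) :=
    { carrier := {j | u ∈ residueOrbitClosure T p u j}
      add_mem' := fun h h' => hadd h h'
      zero_mem' := subset_closure ⟨0, by simp, rfl⟩ }
  -- Finiteness of `ZMod p` makes the submonoid `H` a subgroup.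
  have hneg : ∀ j ∈ H, -j ∈ H := fun j hj => by
    have h := H.nsmul_mem hj (p - 1)
    have : (p - 1) • j = -j := by
      rw [nsmul_eq_mul, Nat.cast_sub hp]
      simp
    rwa [this] at h
  let γ : ℝ → E := fun t => ((1 - t : ℝ) : ℂ) • u + (t : ℂ) • T u
  have hγ : Continuous γ := by fun_prop
  have hγd : ∀ t, DenseRange (fun n : ℕ => T^[n] (γ t)) := fun t => by
    refine denseRange_iterate_smul_add_smul hu ?_
    by_contra! h
    obtain ⟨h1, h2⟩ := h
    norm_cast at h1 h2
    linarith
  let A (S : Set (ZMod p)) : Set ℝ := ⋃ j ∈ S, γ ⁻¹' residueOrbitClosure T p u j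
  have hA : ∀ S, IsClosed (A S) := fun S =>
    S.toFinite.isClosed_biUnion fun j _ => isClosed_closure.preimage hγ
  -- The orbit of `γ t` approaches `u` with some residue `k`; then `i + k` and `j + k` lie in `H`,
  -- hence so does `j = (j + k) - (i + k) + i`.
  have hsep : ∀ t, t ∈ A H → t ∈ A (H : Set (ZMod p))ᶜ → False := by
    intro t h1 h2
    simp only [A, Set.mem_iUnion, Set.mem_preimage] at h1 h2
    obtain ⟨i, hi, hit⟩ := h1
    obtain ⟨j, hj, hjt⟩ := h2
    obtain ⟨k, hk⟩ := exists_mem_residueOrbitClosure (p := p) (hγd t) u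
    have h3 : i + k ∈ H := hadd hit hk
    have h4 : j + k ∈ H := hadd hjt hk
    refine hj ?_
    have := H.add_mem h4 (H.add_mem (hneg _ h3) hi)
    simpa using this
  have hcov : ∀ t, t ∈ A H ∪ A (H : Set (ZMod p))ᶜ := by
    intro t
    obtain ⟨j, hj⟩ := exists_mem_residueOrbitClosure (p := p) hu (γ t)
    by_cases hjH : j ∈ H
    · exact Or.inl (Set.mem_biUnion (x := j) hjH hj)
    · exact Or.inr (Set.mem_biUnion (x := j) hjH hj)
  have h0 : (0 : ℝ) ∈ A H :=
    Set.mem_biUnion (x := 0) H.zero_mem (subset_closure ⟨0, by simp, by simp [γ]⟩)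
  have hcompl : A H = (A (H : Set (ZMod p))ᶜ)ᶜ :=
    Set.ext fun t => ⟨fun h h' => hsep t h h', fun h => (hcov t).resolve_right h⟩
  -- Connectedness of `ℝ` carries membership from `γ 0 = u` to `γ 1 = T u`, which is reached at time
  -- `1`; so `1 ∈ H`.
  have hclopen : IsClopen (A H) := ⟨hA _, by rw [hcompl]; exact (hA _).isOpen_compl⟩
  have h1 : (1 : ℝ) ∈ A H := by simp [hclopen.eq_univ ⟨0, h0⟩]
  have hone : (1 : ZMod p) ∈ H := by
    by_contra hn
    exact hsep 1 h1 (Set.mem_biUnion (x := 1) hn (subset_closure ⟨1, by simp, by simp [γ]⟩))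
  have htop : ∀ j : ZMod p, j ∈ H := fun j => by
    simpa using H.nsmul_mem hone j.val
  intro v
  obtain ⟨j, hj⟩ := exists_mem_residueOrbitClosure (p := p) hu v
  have hv : v ∈ residueOrbitClosure T p u 0 := by
    simpa using hadd (htop (-j)) hj
  refine closure_mono ?_ hv
  rintro _ ⟨n, hn, rfl⟩
  obtain ⟨m, rfl⟩ := (ZMod.natCast_eq_zero_iff n p).1 hn
  refine ⟨m, ?_⟩
  rw [Function.iterate_mul, FunLike.coe_pow_eq_iterate]

end Hypercyclic

/-! ### Closed submonoids and degree on the circle -/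

/-- A closed submonoid of the circle that is not everything has finite exponent. -/
lemma exists_forall_pow_eq_one_of_isClosed (H : Submonoid Circle) (hH : IsClosed (H : Set Circle))
    (hne : ∃ μ, μ ∉ H) : ∃ n : ℕ, 0 < n ∧ ∀ μ ∈ H, μ ^ n = 1 := by
  -- In a compact group, inverses are cluster points of the positive powers.
  have hinv : ∀ μ ∈ H, μ⁻¹ ∈ H := fun μ hμ => by
    have hcl := mapClusterPt_self_zpow_atTop_pow μ (-1)
    have hmem : μ ^ (-1 : ℤ) ∈ closure (H : Set Circle) :=
      mem_closure_iff_clusterPt.2 <| hcl.clusterPt.mono <| by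
        rw [le_principal_iff, mem_map]
        exact Eventually.of_forall fun n => H.pow_mem hμ n
    simpa using hH.closure_subset hmem
  let G : AddSubgroup ℝ :=
    { carrier := {t | Circle.exp t ∈ H}
      add_mem' := fun {a b} ha hb => by
        simpa [Circle.exp_add] using H.mul_mem ha hb
      zero_mem' := by simp
      neg_mem' := fun {a} ha => by simpa using hinv _ ha }
  have hGcl : IsClosed (G : Set ℝ) := hH.preimage Circle.exp.continuous
  rcases G.dense_or_cyclic with hd | ⟨a, ha⟩
  · obtain ⟨μ, hμ⟩ := hne
    obtain ⟨t, rfl⟩ := Circle.exp_surjective μ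
    have : t ∈ (G : Set ℝ) := by
      rw [← hGcl.closure_eq, hd.closure_eq]
      trivial
    exact absurd this hμ
  · have h2π : 2 * Real.pi ∈ G := by
      change Circle.exp _ ∈ H
      simp
    rw [ha, AddSubgroup.mem_closure_singleton] at h2π
    obtain ⟨k, hk⟩ := h2π
    have hk0 : k ≠ 0 := by
      rintro rfl
      simp at hk
    have hek : Circle.exp a ^ k = 1 := by rw [← Circle.exp_zsmul, hk, Circle.exp_two_pi]
    have hen : Circle.exp a ^ k.natAbs = 1 := by
      rcases Int.natAbs_eq k with h | h
      · rw [h] at hek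
        simpa using hek
      · rw [h] at hek
        simpa using hek
    refine ⟨k.natAbs, Int.natAbs_pos.2 hk0, fun μ hμ => ?_⟩
    obtain ⟨t, rfl⟩ := Circle.exp_surjective μ
    have ht : t ∈ G := hμ
    rw [ha, AddSubgroup.mem_closure_singleton] at ht
    obtain ⟨m, rfl⟩ := ht
    rw [Circle.exp_zsmul, ← zpow_natCast, ← zpow_mul, mul_comm, zpow_mul, zpow_natCast, hen,
      one_zpow]

/-- A map from the unit circle to itself of nonzero degree does not extend continuously to the
plane. -/
lemma not_exists_continuous_extension_of_pow {n : ℕ} (hn : 0 < n) (g : C(ℂ, Circle))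
    (hg : ∀ μ : Circle, μ ^ n * g μ = g 1) : False := by
  obtain ⟨e₀, he₀⟩ := Circle.exp_surjective (g 0)
  obtain ⟨F, ⟨-, hF⟩, -⟩ := Circle.isCoveringMap_exp.existsUnique_continuousMap_lifts g 0 e₀ he₀
  have hF' : ∀ z, Circle.exp (F z) = g z := fun z => congrFun hF z
  -- `ψ` lifts the constant map `μ ^ n * g μ`, so it is constant; but its `F` term is `2π`-periodic
  -- while `n * t` grows by `2πn`.
  let ψ : ℝ → ℝ := fun t => n * t + F (Circle.exp t : ℂ)
  have hψ : Continuous ψ := by fun_prop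
  have hexp : ∀ t, Circle.exp (ψ t) = Circle.exp (ψ 0) := fun t => by
    simp only [ψ, Circle.exp_add, Circle.exp_natCast_mul, hF', hg]
  have hconst : ψ (2 * Real.pi) = ψ 0 := by
    exact Circle.isCoveringMap_exp.const_of_comp hψ
      (fun a a' => (hexp a).trans (hexp a').symm) _ _
  simp [ψ, hn.ne'] at hconst

/-! ### Rotations of an operator -/

section Rotation

variable {E : Type*} [AddCommGroup E] [Module ℂ E] [TopologicalSpace E]
  [ContinuousSMul ℂ E]

/-- The closure of the orbit of a vector. -/
def orbitClosure (f : E → E) (u : E) : Set E :=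
  closure (Set.range fun n : ℕ => f^[n] u)

lemma smul_mem_orbitClosure_trans {S : E →L[ℂ] E} {u v w : E} {a b : ℂ}
    (hv : a • v ∈ orbitClosure S u) (hw : b • w ∈ orbitClosure S v) :
    (a * b) • w ∈ orbitClosure S u := by
  have hsub : ∀ y ∈ orbitClosure S v, a • y ∈ orbitClosure S u := fun y hy => by
    refine closure_minimal (t := {y | a • y ∈ orbitClosure S u}) ?_
      (isClosed_closure.preimage (continuous_const_smul a)) hy
    rintro _ ⟨n, rfl⟩
    have : a • S^[n] v = S^[n] (a • v) := by
      rw [← FunLike.coe_pow_eq_iterate, map_smul]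
    rw [Set.mem_ofPred_eq, this]
    refine map_mem_closure (S.continuous.iterate n) hv ?_
    rintro _ ⟨m, rfl⟩
    exact ⟨n + m, Function.iterate_add_apply _ _ _ _⟩
  rw [mul_smul]
  exact hsub _ hw

lemma iterate_smul_apply (T : E →L[ℂ] E) (c : ℂ) (n : ℕ) (u : E) :
    (c • T : E →L[ℂ] E)^[n] u = c ^ n • T^[n] u := by
  induction n with
  | zero => simp
  | succ n ih =>
    rw [Function.iterate_succ_apply', ih, Function.iterate_succ_apply']
    simp [smul_smul, pow_succ]

/-- Projection along the compact circle is a closed map. -/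
lemma isClosed_setOf_exists_circle_smul_mem {Y : Type*} [TopologicalSpace Y] {K : Set E}
    (hK : IsClosed K) {γ : Y → E} (hγ : Continuous γ) {C : Set Circle} (hC : IsClosed C) :
    IsClosed {y | ∃ μ : Circle, μ ∈ C ∧ (μ : ℂ) • γ y ∈ K} := by
  have h : IsClosed {q : Y × Circle | q.2 ∈ C ∧ (q.2 : ℂ) • γ q.1 ∈ K} :=
    (hC.preimage continuous_snd).inter (hK.preimage (by fun_prop))
  convert isClosedMap_fst_of_compactSpace _ h using 1
  ext y
  simp

/-- The two orbits agree up to unimodular factors, and compactness of the circle lets these pass to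
limits. -/
lemma exists_circle_smul_mem_orbitClosure {T : E →L[ℂ] E} {u : E}
    (hu : DenseRange (fun n : ℕ => T^[n] u)) (c : Circle) (v : E) :
    ∃ μ : Circle, (μ : ℂ) • v ∈ orbitClosure ((c : ℂ) • T : E →L[ℂ] E) u := by
  have h := isClosed_setOf_exists_circle_smul_mem (E := E)
    (K := orbitClosure ((c : ℂ) • T : E →L[ℂ] E) u) isClosed_closure continuous_id isClosed_univ
  simp only [Set.mem_univ, true_and, id] at h
  refine closure_minimal ?_ h (hu v)
  rintro _ ⟨n, rfl⟩
  refine ⟨c ^ n, subset_closure ⟨n, ?_⟩⟩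
  simp only [iterate_smul_apply, Circle.coe_pow]

/-- **The León-Saavedra–Müller theorem**: a vector with dense `T`-orbit has dense orbit under every
rotation of `T`. -/
theorem denseRange_iterate_smul [IsTopologicalAddGroup E] [LocallyConvexSpace ℝ E] {T : E →L[ℂ] E} {u : E}
    (hu : DenseRange (fun n : ℕ => T^[n] u)) (c : Circle) :
    DenseRange (fun n : ℕ => ((c : ℂ) • T : E →L[ℂ] E)^[n] u) := by
  set S : E →L[ℂ] E := (c : ℂ) • T
  let H : Submonoid Circle :=
    { carrier := {μ | (μ : ℂ) • u ∈ orbitClosure S u}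
      mul_mem' := fun {a b} h h' => by
        simpa using smul_mem_orbitClosure_trans h h'
      one_mem' := subset_closure ⟨0, by simp⟩ }
  have hHcl : IsClosed (H : Set Circle) :=
    isClosed_closure.preimage (f := fun μ : Circle => (μ : ℂ) • u) (by fun_prop)
  by_cases hne : ∃ μ, μ ∉ H
  · exfalso
    obtain ⟨n, hn, hHn⟩ := exists_forall_pow_eq_one_of_isClosed H hHcl hne
    -- On the unit circle `γ μ = μ • u`; the second term keeps the coefficients from vanishing
    -- together, as it is `T u` at `w = 0`.
    let γ : ℂ → E := fun w => w • u + ((1 - ‖w‖ : ℝ) : ℂ) • T u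
    have hγ : Continuous γ := by fun_prop
    have hγd : ∀ w, DenseRange (fun n : ℕ => T^[n] (γ w)) := fun w => by
      refine denseRange_iterate_smul_add_smul hu ?_
      by_contra! h
      obtain ⟨rfl, h2⟩ := h
      simp at h2
    have hex : ∀ w, ∃ μ : Circle, (μ : ℂ) • γ w ∈ orbitClosure S u := fun w =>
      exists_circle_smul_mem_orbitClosure hu c (γ w)
    choose m hm using hex
    -- Returning from `γ w` to `u` with factor `κ` puts `μ * κ` and `ν * κ` in `H`, whose exponent
    -- divides `n`.
    have huniq : ∀ w (μ ν : Circle), (μ : ℂ) • γ w ∈ orbitClosure S u →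
        (ν : ℂ) • γ w ∈ orbitClosure S u → μ ^ n = ν ^ n := by
      intro w μ ν hμ hν
      obtain ⟨κ, hκ⟩ := exists_circle_smul_mem_orbitClosure (hγd w) c u
      have h1 := hHn (μ * κ) (by
        change ((μ * κ : Circle) : ℂ) • u ∈ orbitClosure S u
        simpa using smul_mem_orbitClosure_trans hμ hκ)
      have h2 := hHn (ν * κ) (by
        change ((ν * κ : Circle) : ℂ) • u ∈ orbitClosure S u
        simpa using smul_mem_orbitClosure_trans hν hκ)
      rw [mul_pow] at h1 h2
      exact mul_right_cancel (h1.trans h2.symm)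
    have hcont : Continuous fun w => m w ^ n := by
      rw [continuous_iff_isClosed]
      intro C hC
      convert isClosed_setOf_exists_circle_smul_mem (K := orbitClosure S u) isClosed_closure hγ
        (hC.preimage (continuous_pow n)) using 1
      ext w
      constructor
      · exact fun h => ⟨m w, h, hm w⟩
      · rintro ⟨μ, hμ, hμw⟩
        change m w ^ n ∈ C
        rw [huniq w _ _ (hm w) hμw]
        exact hμ
    refine not_exists_continuous_extension_of_pow hn ⟨fun w => m w ^ n, hcont⟩ fun μ => ?_
    change μ ^ n * m μ ^ n = m 1 ^ n
    rw [← mul_pow]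
    refine huniq 1 _ _ ?_ (hm 1)
    have h1 := hm μ
    simp only [γ, Circle.norm_coe, sub_self, Complex.ofReal_zero, zero_smul, add_zero] at h1
    simpa [γ, smul_smul, mul_comm] using h1
  · push Not at hne
    intro v
    obtain ⟨κ, hκ⟩ := exists_circle_smul_mem_orbitClosure hu c v
    simpa [orbitClosure] using smul_mem_orbitClosure_trans (hne κ⁻¹) hκ

end Rotation

/-! ### Reduction to a separable subspace and Birkhoff's theorem -/

/-- A countable set is contained in a countable set stable under countably many binary
operations. -/
lemma exists_countable_superset_closed {α ι : Type*} [Countable ι] (op : ι → α → α → α)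
    {A₀ : Set α} (hA₀ : A₀.Countable) :
    ∃ A : Set α, A.Countable ∧ A₀ ⊆ A ∧ ∀ i, ∀ a ∈ A, ∀ b ∈ A, op i a b ∈ A := by
  let step : Set α → Set α := fun B => B ∪ ⋃ i, Set.image2 (op i) B B
  have hmono : Monotone fun n : ℕ => step^[n] A₀ := monotone_nat_of_le_succ fun n => by
    rw [Function.iterate_succ_apply']
    exact Set.subset_union_left
  refine ⟨⋃ n, step^[n] A₀, Set.countable_iUnion fun n => ?_,
    Set.subset_iUnion (fun n => step^[n] A₀) 0, fun i a ha b hb => ?_⟩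
  · induction n with
    | zero => exact hA₀
    | succ n ih =>
      rw [Function.iterate_succ_apply']
      exact ih.union (Set.countable_iUnion fun i => ih.image2 ih _)
  · obtain ⟨m, hm⟩ := Set.mem_iUnion.1 ha
    obtain ⟨n, hn⟩ := Set.mem_iUnion.1 hb
    refine Set.mem_iUnion.2 ⟨max m n + 1, ?_⟩
    rw [Function.iterate_succ_apply']
    exact Or.inr (Set.mem_iUnion.2 ⟨i, a, hmono (le_max_left m n) hm, b,
      hmono (le_max_right m n) hn, rfl⟩)

/-- The closure of a nonempty set stable under addition and under a dense set of scalars, as a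
subspace. -/
def closureSubmodule {X : Type*} [AddCommGroup X] [Module ℂ X] [TopologicalSpace X]
    [IsTopologicalAddGroup X] [ContinuousSMul ℂ X] (A : Set X) (hA : A.Nonempty)
    (hadd : ∀ a ∈ A, ∀ b ∈ A, a + b ∈ A)
    (hsmul : ∀ n, ∀ a ∈ A, TopologicalSpace.denseSeq ℂ n • a ∈ A) : Submodule ℂ X :=
  have hs : ∀ (c : ℂ), ∀ a ∈ closure A, c • a ∈ closure A := fun c a ha => by
    refine closure_minimal (t := {a | c • a ∈ closure A}) (fun a ha => ?_)
      (isClosed_closure.preimage (continuous_const_smul c)) ha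
    refine closure_minimal (t := {c : ℂ | c • a ∈ closure A}) ?_
      (isClosed_closure.preimage (by fun_prop)) (TopologicalSpace.denseRange_denseSeq ℂ c)
    rintro _ ⟨n, rfl⟩
    exact subset_closure (hsmul n a ha)
  { carrier := closure A
    add_mem' := fun ha hb => map_mem_closure₂ continuous_add ha hb hadd
    zero_mem' := by
      obtain ⟨a, ha⟩ := hA
      simpa using hs 0 a (subset_closure ha)
    smul_mem' := fun c a ha => hs c a ha }

/-- Any two points lie in a closed separable invariant subspace on which a transitive operator is
still transitive. -/
lemma exists_separable_submodule {X : Type*} [AddCommGroup X] [Module ℂ X] [TopologicalSpace X]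
    [IsTopologicalAddGroup X] [ContinuousSMul ℂ X] [TopologicalSpace.MetrizableSpace X]
    {T : X →L[ℂ] X} (hT : IsTopTransitive T) (x₀ x₁ : X) :
    ∃ (Y : Submodule ℂ X) (hY : ∀ y ∈ Y, T y ∈ Y), IsClosed (Y : Set X) ∧ x₀ ∈ Y ∧ x₁ ∈ Y ∧
      TopologicalSpace.SeparableSpace Y ∧ IsTopTransitive (T.restrict hY) := by
  let := TopologicalSpace.metrizableSpaceMetric X
  have hpos : ∀ k : ℕ, (0 : ℝ) < 1 / (k + 1) := fun k => Nat.one_div_pos_of_nat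
  have hch : ∀ (k : ℕ) (a b : X), ∃ y ∈ Metric.ball a (1 / (k + 1 : ℝ)),
      ∃ n : ℕ, T^[n] y ∈ Metric.ball b (1 / (k + 1 : ℝ)) := fun k a b => by
    obtain ⟨n, _, ⟨y, hy, rfl⟩, hn⟩ := hT _ _ Metric.isOpen_ball Metric.isOpen_ball
      (Metric.nonempty_ball.2 (hpos k) : (Metric.ball a _).Nonempty)
      (Metric.nonempty_ball.2 (hpos k) : (Metric.ball b _).Nonempty)
    exact ⟨y, hy, n, hn⟩
  choose f hf hfn using hch
  -- Closing up under `f` as well keeps witnesses of transitivity between any two points of `A`, at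
  -- every scale, inside the subspace.
  let op : Bool ⊕ ℕ ⊕ ℕ → X → X → X := Sum.elim
    (fun i a b => bif i then a + b else T a)
    (Sum.elim (fun k a _ => TopologicalSpace.denseSeq ℂ k • a) f)
  obtain ⟨A, hAc, hA₀, hA⟩ := exists_countable_superset_closed op (A₀ := {x₀, x₁}) (by simp)
  have hTA : ∀ a ∈ A, T a ∈ A := fun a ha => hA (Sum.inl false) a ha a ha
  have hfA : ∀ k, ∀ a ∈ A, ∀ b ∈ A, f k a b ∈ A := fun k => hA (Sum.inr (Sum.inr k))
  let Y := closureSubmodule A ⟨x₀, hA₀ (by simp)⟩ (hA (Sum.inl true))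
    fun n a ha => hA (Sum.inr (Sum.inl n)) a ha a ha
  have hAY : A ⊆ Y := subset_closure
  have hY : ∀ y ∈ Y, T y ∈ Y := fun y hy => map_mem_closure T.continuous hy hTA
  refine ⟨Y, hY, isClosed_closure, hAY (hA₀ (by simp)), hAY (hA₀ (by simp)),
    (TopologicalSpace.IsSeparable.closure hAc.isSeparable).separableSpace, ?_⟩
  have hball : ∀ U : Set Y, IsOpen U → U.Nonempty → ∃ a ∈ A, ∃ K : ℕ, ∀ k ≥ K, ∀ y : Y,
      (y : X) ∈ Metric.ball a (1 / (k + 1 : ℝ)) → y ∈ U := by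
    intro U hU hne
    obtain ⟨V, hV, rfl⟩ := isOpen_induced_iff.1 hU
    obtain ⟨y, hyV⟩ := hne
    obtain ⟨a, haV, haA⟩ := mem_closure_iff.1 y.2 V hV hyV
    obtain ⟨ε, hε, hεV⟩ := Metric.isOpen_iff.1 hV a haV
    obtain ⟨K, hK⟩ := exists_nat_one_div_lt hε
    refine ⟨a, haA, K, fun k hk y hy => hεV (Metric.ball_subset_ball ?_ hy)⟩
    exact (Nat.one_div_le_one_div hk).trans hK.le
  intro U V hU hV hUne hVne
  obtain ⟨a, ha, K, hK⟩ := hball U hU hUne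
  obtain ⟨b, hb, M, hM⟩ := hball V hV hVne
  let k := max K M
  let z : Y := ⟨f k a b, hAY (hfA k a ha b hb)⟩
  choose n hn using hfn
  refine ⟨n k a b, _, ⟨z, hK k (le_max_left _ _) z (hf k a b), rfl⟩,
    hM k (le_max_right _ _) _ ?_⟩
  have hiter : ((T.restrict hY)^[n k a b] z : X) = T^[n k a b] z :=
    Function.Semiconj.iterate_right (f := ((↑) : Y → X)) (fun _ => rfl) _ z
  rw [hiter]
  exact hn k a b

/-- **Birkhoff's transitivity theorem**: a transitive continuous self-map of a second countable
Baire space has a dense set of points with dense orbit. -/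
lemma dense_setOf_denseRange_iterate {Y : Type*} [TopologicalSpace Y] [BaireSpace Y]
    [SecondCountableTopology Y] {f : Y → Y} (hf : Continuous f) (hT : IsTopTransitive f) :
    Dense {z | DenseRange fun n : ℕ => f^[n] z} := by
  have hB := TopologicalSpace.isBasis_countableBasis Y
  have hd : Dense (⋂ U ∈ TopologicalSpace.countableBasis Y, ⋃ n : ℕ, f^[n] ⁻¹' U) := by
    refine dense_biInter_of_isOpen
      (fun U hU => isOpen_iUnion fun n => (hB.isOpen hU).preimage (hf.iterate n))
      (TopologicalSpace.countable_countableBasis Y) fun U hU => ?_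
    rw [dense_iff_inter_open]
    intro V hV hVne
    obtain ⟨n, _, ⟨z, hz, rfl⟩, hn⟩ := hT V U hV (hB.isOpen hU) hVne
      (TopologicalSpace.nonempty_of_mem_countableBasis hU)
    exact ⟨z, hz, Set.mem_iUnion.2 ⟨n, hn⟩⟩
  refine hd.mono fun z hz => ?_
  refine hB.dense_iff.2 fun U hU _ => ?_
  obtain ⟨n, hn⟩ := Set.mem_iUnion.1 (Set.mem_iInter₂.1 hz U hU)
  exact ⟨_, hn, n, rfl⟩

/-- The index shift in the proof ensures positive times. -/
lemma mem_limitSet_of_mapClusterPt {Y : Type*} [TopologicalSpace Y] [FirstCountableTopology Y]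
    {f : Y → Y} {y z : Y} (h : MapClusterPt y atTop fun n : ℕ => f^[n] z) : y ∈ limitSet f z := by
  obtain ⟨k, hk, hlim⟩ := h.tendsto_subseq
  exact ⟨fun n => k (n + 1), hk.comp (strictMono_id.add_const 1),
    fun n => (Nat.zero_le _).trans_lt (hk n.lt_succ_self), hlim.comp (tendsto_add_atTop_nat 1)⟩

lemma mem_limitSet_of_semiconj {X Y : Type*} [TopologicalSpace X] [TopologicalSpace Y]
    {f : X → X} {g : Y → Y} {i : Y → X} (hi : Continuous i) (h : Function.Semiconj i g f) {y z : Y}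
    (hy : y ∈ limitSet g z) : i y ∈ limitSet f (i z) := by
  obtain ⟨k, hk, hpos, hlim⟩ := hy
  refine ⟨k, hk, hpos, ?_⟩
  have := (hi.tendsto y).comp hlim
  refine this.congr fun n => ?_
  exact (h.iterate_right (k n)).eq z

/-! ### Recurrence and transitivity of powers and rotations -/

lemma exists_mem_open_forall_mem_limitSet {X : Type*} [AddCommGroup X] [Module ℂ X] [TopologicalSpace X]
    [IsTopologicalAddGroup X] [ContinuousSMul ℂ X] [LocallyConvexSpace ℝ X]
    [TopologicalSpace.IsCompletelyMetrizableSpace X] {T : X →L[ℂ] X} (hT : IsTopTransitive T)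
    (x : X) {U : Set X} (hU : IsOpen U) (hne : U.Nonempty) :
    ∃ z ∈ U, (∀ p : ℕ, 0 < p → z ∈ limitSet (T ^ p : X →L[ℂ] X) z ∧
        x ∈ limitSet (T ^ p : X →L[ℂ] X) z) ∧
      ∀ c : ℂ, ‖c‖ = 1 → z ∈ limitSet (c • T : X →L[ℂ] X) z ∧
        x ∈ limitSet (c • T : X →L[ℂ] X) z := by
  obtain ⟨u, hu⟩ := hne
  obtain ⟨Y, hY, hYcl, huY, hxY, hsep, htr⟩ := exists_separable_submodule hT u x
  have : TopologicalSpace.IsCompletelyMetrizableSpace Y :=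
    hYcl.isClosedEmbedding_subtypeVal.IsCompletelyMetrizableSpace
  have : LocallyConvexSpace ℝ Y :=
    inferInstanceAs (LocallyConvexSpace ℝ (Y.restrictScalars ℝ))
  set R := T.restrict hY
  let := TopologicalSpace.upgradeIsCompletelyMetrizable Y
  have : SecondCountableTopology Y := UniformSpace.secondCountable_of_separable Y
  obtain ⟨z, hz, hzU⟩ := (dense_setOf_denseRange_iterate R.continuous htr).exists_mem_open
    (hU.preimage continuous_subtype_val) ⟨⟨u, huY⟩, hu⟩
  -- Stated for any operator restricting to `Y`, to serve powers and rotations alike.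
  have key : ∀ (R' : Y →L[ℂ] Y) (T' : X →L[ℂ] X), (∀ y : Y, (R' y : X) = T' y) →
      DenseRange (fun n : ℕ => R'^[n] z) → (z : X) ∈ limitSet T' z ∧ x ∈ limitSet T' z := by
    intro R' T' hRT hd
    have hlim : ∀ y : Y, (y : X) ∈ limitSet T' z := fun y =>
      mem_limitSet_of_semiconj continuous_subtype_val hRT
        (mem_limitSet_of_mapClusterPt (mapClusterPt_of_denseRange_iterate hd y))
    exact ⟨hlim z, hlim ⟨x, hxY⟩⟩
  refine ⟨z, hzU, fun p hp => key (R ^ p) (T ^ p) (fun y => ?_) (denseRange_iterate_pow hz hp),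
    fun c hc => key (c • R) (c • T) (fun y => rfl) ?_⟩
  · rw [FunLike.coe_pow_eq_iterate, FunLike.coe_pow_eq_iterate]
    exact Function.Semiconj.iterate_right (f := ((↑) : Y → X)) (fun _ => rfl) p y
  · exact denseRange_iterate_smul hz ⟨c, by simpa [Submonoid.unitSphere] using hc⟩

lemma isTopTransitive_of_forall_limitSet {X : Type*} [TopologicalSpace X] {f : X → X}
    (h : ∀ (x : X) (U : Set X), IsOpen U → U.Nonempty → ∃ z ∈ U, x ∈ limitSet f z) :
    IsTopTransitive f := by
  rintro U V hU hV hUne ⟨x, hx⟩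
  obtain ⟨z, hz, k, -, -, hk⟩ := h x U hU hUne
  obtain ⟨n, hn⟩ := (hk.eventually (hV.mem_nhds hx)).exists
  exact ⟨k n, _, ⟨z, hz, rfl⟩, hn⟩

end TransitiveOperators

theorem theorem3p2 {X : Type*} [AddCommGroup X] [Module ℂ X] [TopologicalSpace X]
    [IsTopologicalAddGroup X] [ContinuousSMul ℂ X] [LocallyConvexSpace ℝ X]
    [TopologicalSpace.IsCompletelyMetrizableSpace X]
    (T : X →L[ℂ] X) (hT : TransitiveOperators.IsTopTransitive (T : X → X)) (x : X) :
    ((∀ p : ℕ, 0 < p → TransitiveOperators.IsTopTransitive ((T ^ p : X →L[ℂ] X) : X → X)) ∧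
      ∃ D : Set X, Dense D ∧ ∀ p : ℕ, 0 < p → ∀ z ∈ D,
        TransitiveOperators.IsRecurrent ((T ^ p : X →L[ℂ] X) : X → X) z ∧
        x ∈ TransitiveOperators.limitSet ((T ^ p : X →L[ℂ] X) : X → X) z) ∧
    ((∀ c : ℂ, ‖c‖ = 1 → TransitiveOperators.IsTopTransitive ((c • T : X →L[ℂ] X) : X → X)) ∧
      ∃ D : Set X, Dense D ∧ ∀ c : ℂ, ‖c‖ = 1 → ∀ z ∈ D,
        TransitiveOperators.IsRecurrent ((c • T : X →L[ℂ] X) : X → X) z ∧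
        x ∈ TransitiveOperators.limitSet ((c • T : X →L[ℂ] X) : X → X) z) := by
  have key := fun (x : X) (U : Set X) (hU : IsOpen U) (hne : U.Nonempty) =>
    TransitiveOperators.exists_mem_open_forall_mem_limitSet hT x hU hne
  refine ⟨⟨fun p hp => ?_, {z | ∀ p : ℕ, 0 < p → _ ∧ _}, ?_, fun p hp z hz => hz p hp⟩,
    ⟨fun c hc => ?_, {z | ∀ c : ℂ, ‖c‖ = 1 → _ ∧ _}, ?_, fun c hc z hz => hz c hc⟩⟩
  · refine TransitiveOperators.isTopTransitive_of_forall_limitSet fun y U hU hne => ?_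
    obtain ⟨z, hz, h, -⟩ := key y U hU hne
    exact ⟨z, hz, (h p hp).2⟩
  · refine dense_iff_inter_open.2 fun U hU hne => ?_
    obtain ⟨z, hz, h, -⟩ := key x U hU hne
    exact ⟨z, hz, h⟩
  · refine TransitiveOperators.isTopTransitive_of_forall_limitSet fun y U hU hne => ?_
    obtain ⟨z, hz, -, h⟩ := key y U hU hne
    exact ⟨z, hz, (h c hc).2⟩
  · refine dense_iff_inter_open.2 fun U hU hne => ?_
    obtain ⟨z, hz, -, h⟩ := key x U hU hne
    exact ⟨z, hz, h⟩
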